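/- Let $k$ be an algebraically closed field of characteristic zero and let $H$ be a Hopf algebra over $k$ whose underlying ring is a (not necessarily commutative) domain. Let $C_0$ be the coradical of $H$, that is, the sum of all simple subcoalgebras of $H$. Suppose that $H$ is pointed (every simple subcoalgebra of $H$ is one-dimensional; then $C_0$ is a subalgebra of $H$, spanned by the grouplike elements), that $C_0$ is commutative, and that the Gelfand–Kirillov dimensions over $k$ satisfy $$\operatorname{GKdim} H<\operatorname{GKdim} C_0+2<\infty .$$ For a grouplike element $g\in H$ and a scalar $\lambda\in k$ let $$P_{g,\lambda,1}=\{\,y\in H \;:\; \Delta(y)=y\otimes 1+g\otimes y \ \text{ and }\ g^{-1}yg-\lambda y\in C_0\,\},$$ a subspace of $H$ containing $k(g-1)$, and let $P'_{g,\lambda,1}=P_{g,\lambda,1}/k(g-1)$. Then $$\dim_k P'_{g,\lambda,1}\le 1\qquad\text{for all grouplike } g\in H \text{ and all } \lambda\in k .$$ -/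

import Mathlib

open scoped TensorProduct ENNReal

noncomputable section

namespace PointedHopf

section GrowthDimension

/-- The growth rate `limsup_n log (dim (k + V)^n) / log n` of an algebra with respect to a
subspace `V` (meant for finite-dimensional `V`, where `(k + V)^n = k + V + ⋯ + V^n` is
finite-dimensional). All the quotients are nonnegative for a nonzero algebra. -/
def growthRate (k : Type*) {A : Type*} [Field k] [Ring A] [Algebra k A]
    (V : Submodule k A) : ℝ≥0∞ :=
  Filter.limsup
    (fun n : ℕ => ENNReal.ofReal
      (Real.log (Module.finrank k ((1 ⊔ V) ^ n : Submodule k A)) / Real.log n))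
    Filter.atTop

/-- The Gelfand–Kirillov dimension of an algebra `A` over a field `k`: the supremum of the growth
rates over all finite-dimensional subspaces of `A`. -/
def gkDim (k A : Type*) [Field k] [Ring A] [Algebra k A] : ℝ≥0∞ :=
  ⨆ (V : Submodule k A) (_ : V.FG), growthRate k V

end GrowthDimension

section Coalgebra

variable {k C : Type*} [Field k] [AddCommGroup C] [Module k C] [Coalgebra k C]

/-- A subspace `D` with `Δ(D) ⊆ D ⊗ D`, the latter regarded as a subspace of `C ⊗ C`. -/
def IsSubcoalgebra (D : Submodule k C) : Prop :=
  ∀ x ∈ D, (Coalgebra.comul x : C ⊗[k] C) ∈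
    LinearMap.range (TensorProduct.map D.subtype D.subtype)

/-- A nonzero subcoalgebra without proper nonzero subcoalgebras. -/
def IsSimpleSubcoalgebra (D : Submodule k C) : Prop :=
  IsSubcoalgebra D ∧ D ≠ ⊥ ∧ ∀ E : Submodule k C, IsSubcoalgebra E → E ≤ D → E = ⊥ ∨ E = D

variable (k C) in
/-- The coradical `C₀`: the sum of all simple subcoalgebras. -/
def coradical : Submodule k C :=
  sSup {D : Submodule k C | IsSimpleSubcoalgebra D}

variable (k C) in
/-- A coalgebra is pointed if all its simple subcoalgebras are one-dimensional. -/
def IsPointed : Prop :=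
  ∀ D : Submodule k C, IsSimpleSubcoalgebra D → Module.finrank k D = 1

theorem isSimpleSubcoalgebra_span_singleton {g : C} (hg : IsGroupLikeElem k g) :
    IsSimpleSubcoalgebra (k ∙ g) := by
  have hg0 : g ≠ 0 := hg.ne_zero
  refine ⟨?_, ?_, ?_⟩
  · intro x hx
    obtain ⟨c, rfl⟩ := Submodule.mem_span_singleton.1 hx
    rw [map_smul, hg.comul_eq_tmul_self]
    refine Submodule.smul_mem _ _ ?_
    let g' : (k ∙ g : Submodule k C) := ⟨g, Submodule.mem_span_singleton_self g⟩
    exact ⟨g' ⊗ₜ[k] g', by simp [g']⟩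
  · simpa [Submodule.span_singleton_eq_bot] using hg0
  · intro E _ hE
    by_cases h : E = ⊥
    · exact Or.inl h
    · right
      obtain ⟨x, hx, hx0⟩ := Submodule.exists_mem_ne_zero_of_ne_bot h
      obtain ⟨c, rfl⟩ := Submodule.mem_span_singleton.1 (hE hx)
      have hc : c ≠ 0 := by rintro rfl; simp at hx0
      refine le_antisymm hE ?_
      rw [Submodule.span_singleton_le_iff_mem]
      simpa [smul_smul, hc] using E.smul_mem c⁻¹ hx

theorem exists_isGroupLikeElem_of_finrank_eq_one {D : Submodule k C} (hD : IsSubcoalgebra D)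
    (h1 : Module.finrank k D = 1) : ∃ g : C, IsGroupLikeElem k g ∧ D = k ∙ g := by
  obtain ⟨v, hv0, hv⟩ := finrank_eq_one_iff'.1 h1
  obtain ⟨t, ht⟩ := hD v v.2
  have key : ∀ t : D ⊗[k] D, ∃ c : k,
      TensorProduct.map D.subtype D.subtype t = c • ((v : C) ⊗ₜ[k] (v : C)) := by
    intro t
    induction t with
    | zero => exact ⟨0, by simp⟩
    | tmul a b =>
      obtain ⟨r, rfl⟩ := hv a
      obtain ⟨s, rfl⟩ := hv b
      exact ⟨r * s, by simp [TensorProduct.smul_tmul', TensorProduct.tmul_smul, smul_smul,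
        mul_comm]⟩
    | add a b ha hb =>
      obtain ⟨r, hr⟩ := ha
      obtain ⟨s, hs⟩ := hb
      exact ⟨r + s, by rw [map_add, hr, hs, add_smul]⟩
  obtain ⟨c, hc⟩ := key t
  rw [hc] at ht
  have hv0' : (v : C) ≠ 0 := by simpa using hv0
  have h2 := Coalgebra.rTensor_counit_comul (R := k) (v : C)
  rw [← ht] at h2
  have h3 := congrArg (TensorProduct.lid k C) h2
  simp only [map_smul, LinearMap.rTensor_tmul, TensorProduct.lid_tmul, one_smul, smul_smul] at h3
  have h4 : c * Coalgebra.counit (R := k) (v : C) = 1 := by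
    have : (c * Coalgebra.counit (R := k) (v : C) - 1) • (v : C) = 0 := by
      rw [sub_smul, h3, one_smul, sub_self]
    rcases smul_eq_zero.1 this with h | h
    · exact sub_eq_zero.1 h
    · exact absurd h hv0'
  have hc0 : c ≠ 0 := by rintro rfl; simp at h4
  refine ⟨c • (v : C), ⟨by simpa using h4, ?_⟩, ?_⟩
  · rw [map_smul, ← ht, TensorProduct.smul_tmul', TensorProduct.tmul_smul]
  · apply le_antisymm
    · intro x hx
      obtain ⟨r, hr⟩ := hv ⟨x, hx⟩
      refine Submodule.mem_span_singleton.2 ⟨r * c⁻¹, ?_⟩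
      rw [smul_smul, mul_assoc, inv_mul_cancel₀ hc0, mul_one]
      exact congrArg Subtype.val hr
    · rw [Submodule.span_singleton_le_iff_mem]
      exact D.smul_mem c v.2

/-- In a pointed coalgebra the coradical is spanned by the grouplike elements. -/
theorem IsPointed.coradical_eq_span (h : IsPointed k C) :
    coradical k C = Submodule.span k {g : C | IsGroupLikeElem k g} := by
  apply le_antisymm
  · refine sSup_le fun D hD => ?_
    obtain ⟨g, hg, rfl⟩ := exists_isGroupLikeElem_of_finrank_eq_one hD.1 (h D hD)
    exact Submodule.span_mono (by simpa using hg)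
  · refine Submodule.span_le.2 fun g hg => ?_
    exact (le_sSup (isSimpleSubcoalgebra_span_singleton hg) : (k ∙ g) ≤ coradical k C)
      (Submodule.mem_span_singleton_self g)

end Coalgebra

section Hopf

variable (k H : Type*) [Field k] [Ring H] [HopfAlgebra k H]

/-- The subalgebra generated by the coradical; in the pointed case it is the coradical itself,
see `IsPointed.toSubmodule_coradicalSubalgebra`. -/
def coradicalSubalgebra : Subalgebra k H :=
  Algebra.adjoin k (coradical k H : Set H)

variable {k H} in
/-- The coradical of a pointed Hopf algebra is a subalgebra. -/
theorem IsPointed.toSubmodule_coradicalSubalgebra (h : IsPointed k H) :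
    Subalgebra.toSubmodule (coradicalSubalgebra k H) = coradical k H := by
  have hG : {g : H | IsGroupLikeElem k g} = (groupLikeSubmonoid k H : Set H) := rfl
  rw [coradicalSubalgebra, h.coradical_eq_span, Algebra.adjoin_span, Algebra.adjoin_eq_span, hG,
    Submonoid.closure_eq]

variable {k H}

/-- The space `P_{g,*,*}` of all `(1,g)`-primitive elements: `Δ(y) = y ⊗ 1 + g ⊗ y`. -/
def skewPrimitives (g : GroupLike k H) : Submodule k H where
  carrier := {y | (Coalgebra.comul y : H ⊗[k] H) = y ⊗ₜ[k] 1 + (g : H) ⊗ₜ[k] y}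
  zero_mem' := by simp
  add_mem' := by
    intro a b ha hb
    simp only [Set.mem_ofPred_eq] at ha hb ⊢
    rw [map_add, ha, hb, TensorProduct.add_tmul, TensorProduct.tmul_add]
    abel
  smul_mem' := by
    intro c a ha
    simp only [Set.mem_ofPred_eq] at ha ⊢
    rw [map_smul, ha, smul_add, TensorProduct.smul_tmul', TensorProduct.tmul_smul]

/-- The inverse conjugation `T_{g⁻¹} : a ↦ g⁻¹ a g`. -/
def invConj (g : GroupLike k H) : Module.End k H :=
  LinearMap.mulLeft k ((g⁻¹ : GroupLike k H) : H) * LinearMap.mulRight k (g : H)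

/-- The space `P_{g,λ,n}` of the `(1,g)`-primitive elements having commutator `λ` of level at most
`n`, that is, of those `(1,g)`-primitive `y` with `(T_{g⁻¹} - λ)^n (y) ∈ C₀`. -/
def skewPrimitivesWithCommutator (g : GroupLike k H) (lam : k) (n : ℕ) : Submodule k H :=
  skewPrimitives g ⊓
    (coradical k H).comap ((invConj g - algebraMap k (Module.End k H) lam) ^ n)

/-- Trivial skew primitives have commutator of level at most `n`, so `k(g - 1) ⊆ P_{g,λ,n}`. -/
theorem span_sub_one_le (h : IsPointed k H) (g : GroupLike k H) (lam : k) (n : ℕ) :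
    (k ∙ ((g : H) - 1)) ≤ skewPrimitivesWithCommutator g lam n := by
  have hT : ∀ m : ℕ, ((invConj g - algebraMap k (Module.End k H) lam) ^ m) ((g : H) - 1) =
      (1 - lam) ^ m • ((g : H) - 1) := by
    intro m
    induction m with
    | zero => simp
    | succ m ih =>
      have h1 : invConj g ((g : H) - 1) = (g : H) - 1 := by
        simp [invConj, mul_sub, sub_mul, ← mul_assoc]
      rw [pow_succ', Module.End.mul_apply, ih, map_smul, LinearMap.sub_apply, h1,
        Module.algebraMap_end_apply, pow_succ, mul_smul, sub_smul, one_smul]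
  rw [Submodule.span_singleton_le_iff_mem]
  refine ⟨?_, ?_⟩
  · change (Coalgebra.comul ((g : H) - 1) : H ⊗[k] H) = _
    rw [map_sub, g.2.comul_eq_tmul_self, Bialgebra.comul_one, TensorProduct.sub_tmul,
      TensorProduct.tmul_sub, Algebra.TensorProduct.one_def]
    abel
  · rw [Submodule.comap_coe, Set.mem_preimage, hT, SetLike.mem_coe, h.coradical_eq_span]
    exact Submodule.smul_mem _ _ (Submodule.sub_mem _ (Submodule.subset_span g.2)
      (Submodule.subset_span .one))

/-- The quotient space `P'_{g,λ,n} = P_{g,λ,n} / k(g - 1)`. -/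
abbrev SkewPrimitivesQuotient (g : GroupLike k H) (lam : k) (n : ℕ) : Type _ :=
  skewPrimitivesWithCommutator g lam n ⧸
    (k ∙ ((g : H) - 1)).submoduleOf (skewPrimitivesWithCommutator g lam n)

end Hopf

end PointedHopf

end

open scoped TensorProduct ENNReal

noncomputable section

namespace PointedHopf

section Growth

variable {k H : Type*} [Field k] [Ring H] [Algebra k H]

theorem finrank_pow_mul_sq_le (A : Subalgebra k H) (y₁ y₂ : H)
    (hind : ∀ (s : Finset (ℕ × ℕ)) (u : ℕ × ℕ → H), (∀ p, u p ∈ A) →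
      ∑ p ∈ s, u p * (y₁ ^ p.1 * y₂ ^ p.2) = 0 → ∀ p ∈ s, u p = 0)
    (V : Submodule k A) (hV : V.FG) (n : ℕ) :
    Module.finrank k ((1 ⊔ V) ^ n : Submodule k A) * n ^ 2 ≤
      Module.finrank k
        ((1 ⊔ (V.map A.val.toLinearMap ⊔ Submodule.span k {y₁, y₂})) ^ (3 * n) :
          Submodule k H) := by
  set W : Submodule k H := 1 ⊔ (V.map A.val.toLinearMap ⊔ Submodule.span k {y₁, y₂}) with hW
  have h1A : (1 : Submodule k A).FG := by
    rw [Submodule.one_eq_span]; exact Submodule.fg_span_singleton _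
  have h1H : (1 : Submodule k H).FG := by
    rw [Submodule.one_eq_span]; exact Submodule.fg_span_singleton _
  have hWfg : W.FG :=
    h1H.sup ((hV.map _).sup (Submodule.fg_span ((Set.finite_singleton y₂).insert y₁)))
  have : Module.Finite k (W ^ (3 * n) : Submodule k H) := Module.Finite.iff_fg.2 (hWfg.pow _)
  have : Module.Finite k ((1 ⊔ V) ^ n : Submodule k A) :=
    Module.Finite.iff_fg.2 ((h1A.sup hV).pow _)
  have h1W : (1 : Submodule k H) ≤ W := le_sup_left
  have hy₁ : y₁ ∈ W := le_sup_right (a := (1 : Submodule k H))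
    (le_sup_right (a := V.map A.val.toLinearMap) (Submodule.subset_span (by simp)))
  have hy₂ : y₂ ∈ W := le_sup_right (a := (1 : Submodule k H))
    (le_sup_right (a := V.map A.val.toLinearMap) (Submodule.subset_span (by simp)))
  have hpow : ∀ {y : H}, y ∈ W → ∀ i < n, y ^ i ∈ W ^ n := fun hy i hi =>
    pow_le_pow_right' h1W hi.le (Submodule.pow_mem_pow W hy i)
  have hVW : ∀ v ∈ ((1 ⊔ V) ^ n : Submodule k A), (v : H) ∈ W ^ n := by
    intro v hv
    have h : ((1 ⊔ V) ^ n).map A.val.toLinearMap ≤ W ^ n := by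
      rw [Submodule.map_pow, Submodule.map_sup, Submodule.map_one]
      exact pow_le_pow_left' (sup_le_sup_left le_sup_left _) n
    exact h (Submodule.mem_map_of_mem hv)
  let Φ : (Fin n × Fin n → ((1 ⊔ V) ^ n : Submodule k A)) →ₗ[k] H :=
    ∑ p : Fin n × Fin n, LinearMap.mulRight k (y₁ ^ (p.1 : ℕ) * y₂ ^ (p.2 : ℕ)) ∘ₗ
      A.val.toLinearMap ∘ₗ Submodule.subtype _ ∘ₗ LinearMap.proj p
  have hΦ : ∀ u, Φ u = ∑ p : Fin n × Fin n, ((u p : A) : H) *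
      (y₁ ^ (p.1 : ℕ) * y₂ ^ (p.2 : ℕ)) := by
    intro u; simp [Φ, mul_assoc]
  have hmem : ∀ u, Φ u ∈ W ^ (3 * n) := by
    intro u
    rw [hΦ, show 3 * n = n + (n + n) by ring, pow_add, pow_add]
    exact Submodule.sum_mem _ fun p _ => Submodule.mul_mem_mul (hVW _ (u p).2)
      (Submodule.mul_mem_mul (hpow hy₁ _ p.1.2) (hpow hy₂ _ p.2.2))
  have hinj : Function.Injective (Φ.codRestrict _ hmem) := by
    rw [← LinearMap.ker_eq_bot, LinearMap.ker_codRestrict, LinearMap.ker_eq_bot']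
    intro u hu
    rw [hΦ] at hu
    let e : Fin n × Fin n ↪ ℕ × ℕ := Fin.valEmbedding.prodMap Fin.valEmbedding
    let w : ℕ × ℕ → H := Function.extend e (fun p => ((u p : A) : H)) 0
    have hw : ∀ p, w (e p) = ((u p : A) : H) := fun p => e.injective.extend_apply _ _ p
    have hwA : ∀ p, w p ∈ A := by
      intro p
      by_cases h : ∃ q, e q = p
      · obtain ⟨q, rfl⟩ := h
        rw [hw]; exact (u q : A).2
      · simp only [w]
        rw [Function.extend_apply' _ _ _ h]; exact A.zero_mem
    have := hind (Finset.univ.map e) w hwA (by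
      rw [Finset.sum_map]
      simp only [hw]
      exact hu)
    funext p
    have h2 := this (e p) (Finset.mem_map_of_mem e (Finset.mem_univ p))
    rw [hw] at h2
    exact Subtype.ext (Subtype.ext h2)
  have := LinearMap.finrank_le_finrank_of_injective hinj
  rw [Module.finrank_pi_fintype] at this
  simpa [sq, mul_comm] using this

theorem tendsto_log_div_log_three_mul :
    Filter.Tendsto (fun n : ℕ => Real.log n / Real.log ((3 * n : ℕ) : ℝ)) Filter.atTop
      (nhds 1) := by
  have hlog : Filter.Tendsto (fun n : ℕ => Real.log n) Filter.atTop Filter.atTop :=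
    Real.tendsto_log_atTop.comp tendsto_natCast_atTop_atTop
  have h0 : Filter.Tendsto (fun n : ℕ => (Real.log 3 / Real.log n + 1)⁻¹) Filter.atTop
      (nhds 1) := by
    simpa using ((hlog.const_div_atTop (Real.log 3)).add_const 1).inv₀ (by norm_num)
  refine h0.congr' ?_
  filter_upwards [Filter.eventually_ge_atTop 2] with n hn
  have hn' : (2 : ℝ) ≤ n := by exact_mod_cast hn
  have hl : 0 < Real.log n := Real.log_pos (by linarith)
  have h3 : 0 < Real.log 3 := Real.log_pos (by norm_num)
  push_cast
  rw [Real.log_mul (by norm_num) (by linarith)]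
  field_simp

theorem log_div_log_add_two_mul_le {d e n : ℕ} (hd : 0 < d) (hn : 2 ≤ n)
    (h : d * n ^ 2 ≤ e) :
    (ENNReal.ofReal (Real.log d / Real.log n) + 2) *
      ENNReal.ofReal (Real.log n / Real.log ((3 * n : ℕ) : ℝ)) ≤
        ENNReal.ofReal (Real.log e / Real.log ((3 * n : ℕ) : ℝ)) := by
  have hn' : (2 : ℝ) ≤ n := by exact_mod_cast hn
  have hl : 0 < Real.log n := Real.log_pos (by linarith)
  have hl3 : 0 < Real.log ((3 * n : ℕ) : ℝ) := by
    apply Real.log_pos; push_cast; linarith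
  have hd' : (1 : ℝ) ≤ d := by exact_mod_cast hd
  have hx0 : 0 ≤ Real.log d / Real.log n := div_nonneg (Real.log_nonneg hd') hl.le
  have h2 : (2 : ℝ≥0∞) = ENNReal.ofReal 2 := by simp
  rw [h2, ← ENNReal.ofReal_add hx0 zero_le_two,
    ← ENNReal.ofReal_mul (add_nonneg hx0 zero_le_two)]
  apply ENNReal.ofReal_le_ofReal
  have key : (d : ℝ) * (n : ℝ) ^ 2 ≤ e := by exact_mod_cast h
  have hlog := Real.log_le_log (by positivity) key
  rw [Real.log_mul (by positivity) (by positivity), Real.log_pow] at hlog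
  rw [← mul_div_assoc]
  apply div_le_div_of_nonneg_right _ hl3.le
  rw [add_mul, div_mul_cancel₀ _ hl.ne']
  exact_mod_cast hlog

theorem limsup_log_div_log_add_two_le (d e : ℕ → ℕ) (hd : ∀ n, 0 < d n)
    (h : ∀ n, d n * n ^ 2 ≤ e (3 * n)) :
    Filter.limsup (fun n : ℕ => ENNReal.ofReal (Real.log (d n) / Real.log n)) Filter.atTop + 2 ≤
      Filter.limsup (fun n : ℕ => ENNReal.ofReal (Real.log (e n) / Real.log n)) Filter.atTop := by
  have htlim := ENNReal.tendsto_ofReal tendsto_log_div_log_three_mul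
  rw [ENNReal.ofReal_one] at htlim
  have h3 : Filter.Tendsto (fun n : ℕ => 3 * n) Filter.atTop Filter.atTop :=
    Filter.tendsto_id.const_mul_atTop' three_pos
  rw [← limsup_add_const _ _ _ (by isBoundedDefault) (by isBoundedDefault), ← mul_one
    (Filter.limsup _ _), ← htlim.liminf_eq]
  refine ENNReal.le_limsup_mul.trans (le_trans (Filter.limsup_le_limsup ?_)
    (Filter.Tendsto.limsup_comp_le_limsup
      (u := fun n : ℕ => ENNReal.ofReal (Real.log (e n) / Real.log n)) h3))
  filter_upwards [Filter.eventually_ge_atTop 2] with n hn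
  exact log_div_log_add_two_mul_le (hd n) hn (h n)

theorem growthRate_add_two_le [Nontrivial H] (A : Subalgebra k H) (y₁ y₂ : H)
    (hind : ∀ (s : Finset (ℕ × ℕ)) (u : ℕ × ℕ → H), (∀ p, u p ∈ A) →
      ∑ p ∈ s, u p * (y₁ ^ p.1 * y₂ ^ p.2) = 0 → ∀ p ∈ s, u p = 0)
    (V : Submodule k A) (hV : V.FG) :
    growthRate k V + 2 ≤
      growthRate k (V.map A.val.toLinearMap ⊔ Submodule.span k {y₁, y₂}) := by
  refine limsup_log_div_log_add_two_le
    (fun n => Module.finrank k ((1 ⊔ V) ^ n : Submodule k A)) _ (fun n => ?_)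
    (fun n => finrank_pow_mul_sq_le A y₁ y₂ hind V hV n)
  have h1A : (1 : Submodule k A).FG := by
    rw [Submodule.one_eq_span]; exact Submodule.fg_span_singleton _
  have : Module.Finite k ((1 ⊔ V) ^ n : Submodule k A) :=
    Module.Finite.iff_fg.2 ((h1A.sup hV).pow _)
  have h1 : (1 : A) ∈ ((1 ⊔ V) ^ n : Submodule k A) :=
    one_le_pow_of_one_le' (le_sup_left : (1 : Submodule k A) ≤ 1 ⊔ V) n
      (Submodule.one_le.1 le_rfl)
  have : Nontrivial ((1 ⊔ V) ^ n : Submodule k A) :=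
    ⟨⟨⟨1, h1⟩, 0, fun h => one_ne_zero (congrArg Subtype.val h)⟩⟩
  exact Module.finrank_pos

/-- If the monomials `y₁ ^ a * y₂ ^ b` are left linearly independent over a subalgebra `A`, then
the Gelfand–Kirillov dimension exceeds that of `A` by at least two. -/
theorem gkDim_add_two_le [Nontrivial H] (A : Subalgebra k H) (y₁ y₂ : H)
    (hind : ∀ (s : Finset (ℕ × ℕ)) (u : ℕ × ℕ → H), (∀ p, u p ∈ A) →
      ∑ p ∈ s, u p * (y₁ ^ p.1 * y₂ ^ p.2) = 0 → ∀ p ∈ s, u p = 0) :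
    gkDim k A + 2 ≤ gkDim k H := by
  rw [gkDim, iSup_subtype']
  have : Nonempty {V : Submodule k A // V.FG} := ⟨⟨⊥, Submodule.fg_bot⟩⟩
  rw [ENNReal.iSup_add]
  refine iSup_le fun V => (growthRate_add_two_le A y₁ y₂ hind V.1 V.2).trans ?_
  exact le_iSup₂_of_le (f := fun (W : Submodule k H) (_ : W.FG) => growthRate k W) _
    ((V.2.map _).sup (Submodule.fg_span ((Set.finite_singleton y₂).insert y₁))) le_rfl

end Growth

section QCommuting

variable {k A : Type*} [Field k] [Ring A] [Algebra k A]

/-- The Gaussian binomial coefficients, by the `q`-Pascal recursion. -/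
def gaussBinom (q : k) : ℕ → ℕ → k
  | _, 0 => 1
  | 0, _ + 1 => 0
  | n + 1, i + 1 => gaussBinom q n i + q ^ (i + 1) * gaussBinom q n (i + 1)

@[simp] theorem gaussBinom_zero_right (q : k) (n : ℕ) : gaussBinom q n 0 = 1 := by
  cases n <;> rfl

theorem gaussBinom_eq_zero_of_lt (q : k) {n i : ℕ} (h : n < i) : gaussBinom q n i = 0 := by
  induction n generalizing i with
  | zero => obtain ⟨i, rfl⟩ := Nat.exists_eq_succ_of_ne_zero h.ne'; rfl
  | succ n ih =>
    obtain ⟨i, rfl⟩ := Nat.exists_eq_succ_of_ne_zero (Nat.ne_zero_of_lt h)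
    rw [gaussBinom, ih (by omega), ih (by omega), mul_zero, add_zero]

@[simp] theorem gaussBinom_self (q : k) (n : ℕ) : gaussBinom q n n = 1 := by
  induction n with
  | zero => rfl
  | succ n ih => rw [gaussBinom, ih, gaussBinom_eq_zero_of_lt q (Nat.lt_succ_self n), mul_zero,
      add_zero]

theorem gaussBinom_succ_mul (q : k) (n i : ℕ) (h : i ≤ n) :
    gaussBinom q n (i + 1) * (1 - q ^ (i + 1)) = gaussBinom q n i * (1 - q ^ (n - i)) := by
  induction n generalizing i with
  | zero => obtain rfl : i = 0 := by omega
            simp [gaussBinom]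
  | succ n ih =>
    rcases Nat.eq_or_lt_of_le h with rfl | h
    · rw [gaussBinom_eq_zero_of_lt q (Nat.lt_succ_self _)]; simp
    · have hi : i ≤ n := by omega
      obtain ⟨m, rfl⟩ := Nat.exists_eq_add_of_le hi
      have h1 := ih i hi
      rw [Nat.add_sub_cancel_left] at h1
      rw [show i + m + 1 - i = m + 1 by omega, gaussBinom]
      cases i with
      | zero =>
        simp only [gaussBinom_zero_right] at h1 ⊢
        linear_combination q ^ (0 + 1) * h1
      | succ j =>
        have h2 := ih j (by omega)
        rw [show j + 1 + m - j = m + 1 by omega] at h2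
        rw [gaussBinom]
        linear_combination q ^ (j + 1 + 1) * h1 + h2

theorem gaussBinom_eq_zero_of_isPrimitiveRoot {q : k} {n i : ℕ} (hq : IsPrimitiveRoot q n)
    (hi : 0 < i) (hin : i < n) : gaussBinom q n i = 0 := by
  induction i with
  | zero => omega
  | succ i ih =>
    have h := gaussBinom_succ_mul q n i (by omega)
    have h0 : gaussBinom q n i * (1 - q ^ (n - i)) = 0 := by
      rcases Nat.eq_zero_or_pos i with rfl | hi
      · simp [hq.pow_eq_one]
      · rw [ih hi (by omega), zero_mul]
    rw [h0] at h
    exact (mul_eq_zero.1 h).resolve_right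
      (sub_ne_zero.2 (hq.pow_ne_one_of_pos_of_lt (by omega) hin).symm)

theorem mul_pow_of_mul_eq_smul_mul {q : k} {x y : A} (h : x * y = q • (y * x)) (n : ℕ) :
    x * y ^ n = q ^ n • (y ^ n * x) := by
  induction n with
  | zero => simp
  | succ n ih =>
    rw [pow_succ, ← mul_assoc, ih, smul_mul_assoc, mul_assoc, h, mul_smul_comm, smul_smul,
      mul_assoc, pow_succ]

theorem pow_mul_of_mul_eq_smul_mul {q : k} {x y : A} (h : x * y = q • (y * x)) (n : ℕ) :
    x ^ n * y = q ^ n • (y * x ^ n) := by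
  induction n with
  | zero => simp
  | succ n ih =>
    rw [pow_succ, mul_assoc, h, mul_smul_comm, ← mul_assoc, ih, smul_mul_assoc, smul_smul,
      mul_assoc, ← pow_succ']

/-- The `q`-binomial theorem. -/
theorem add_pow_of_mul_eq_smul_mul {q : k} {x y : A} (h : x * y = q • (y * x)) (n : ℕ) :
    (x + y) ^ n = ∑ i ∈ Finset.range (n + 1), gaussBinom q n i • (y ^ i * x ^ (n - i)) := by
  induction n with
  | zero => simp
  | succ n ih =>
    rw [pow_succ', ih, add_mul, Finset.sum_range_succ' _ (n + 1)]
    simp only [gaussBinom, add_smul, Finset.sum_add_distrib]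
    rw [Finset.sum_range_succ (fun i => (q ^ (i + 1) * gaussBinom q n (i + 1)) • _) n,
      gaussBinom_eq_zero_of_lt q (Nat.lt_succ_self n), mul_zero, zero_smul, add_zero,
      Finset.mul_sum, Finset.mul_sum, Finset.sum_range_succ' _ n, add_comm, ← add_assoc]
    congr 1
    · congr 1
      · refine Finset.sum_congr rfl fun i _ => ?_
        rw [mul_smul_comm, ← mul_assoc, ← pow_succ', Nat.succ_sub_succ]
      · refine Finset.sum_congr rfl fun i hi => ?_
        rw [Finset.mem_range] at hi
        rw [mul_smul_comm, ← mul_assoc, mul_pow_of_mul_eq_smul_mul h, smul_mul_assoc, smul_smul,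
          mul_assoc, ← pow_succ', mul_comm]
        congr 4
        omega
    · simp [pow_succ']

theorem add_pow_of_isPrimitiveRoot {q : k} {n : ℕ} (hn : 0 < n) (hq : IsPrimitiveRoot q n) {x y : A}
    (h : x * y = q • (y * x)) : (x + y) ^ n = x ^ n + y ^ n := by
  rw [add_pow_of_mul_eq_smul_mul h]
  obtain ⟨m, rfl⟩ := Nat.exists_eq_succ_of_ne_zero hn.ne'
  rw [Finset.sum_range_succ, Finset.sum_range_succ', Finset.sum_eq_zero]
  · simp
  · intro i hi
    rw [Finset.mem_range] at hi
    rw [gaussBinom_eq_zero_of_isPrimitiveRoot hq (by omega) (by omega), zero_smul]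

end QCommuting

section PowerSpan

variable {k A : Type*} [Field k] [Ring A] [Algebra k A]

variable (k) in
/-- The span of the elements `g ^ j * y ^ m` with `m < n`. -/
def powerSpan (g y : A) (n : ℕ) : Submodule k A :=
  Submodule.span k {x | ∃ j m, m < n ∧ g ^ j * y ^ m = x}

variable {g y : A} {lam c : k} {m n : ℕ}

theorem pow_mul_pow_mem_powerSpan (g y : A) (j : ℕ) (h : m < n) :
    g ^ j * y ^ m ∈ powerSpan k g y n :=
  Submodule.subset_span ⟨j, m, h, rfl⟩

theorem pow_mem_powerSpan (g y : A) (h : m < n) : y ^ m ∈ powerSpan k g y n := by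
  simpa using pow_mul_pow_mem_powerSpan (k := k) g y 0 h

theorem mul_pow_mem_powerSpan (g y : A) (h : m < n) : g * y ^ m ∈ powerSpan k g y n := by
  simpa using pow_mul_pow_mem_powerSpan (k := k) g y 1 h

theorem powerSpan_mono (g y : A) : Monotone (powerSpan k g y) := fun _ _ h =>
  Submodule.span_mono fun _ ⟨j, m, hm, hx⟩ => ⟨j, m, hm.trans_le h, hx⟩

theorem mul_right_mem_powerSpan {x : A} (hx : x ∈ powerSpan k g y n) :
    x * y ∈ powerSpan k g y (n + 1) := by
  have : powerSpan k g y n ≤ (powerSpan k g y (n + 1)).comap (LinearMap.mulRight k y) := by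
    refine Submodule.span_le.2 ?_
    rintro _ ⟨j, m, hm, rfl⟩
    simpa [mul_assoc, ← pow_succ] using
      pow_mul_pow_mem_powerSpan (k := k) g y j (Nat.succ_lt_succ hm)
  exact this hx

theorem mul_left_mem_powerSpan {x : A} (hx : x ∈ powerSpan k g y n) :
    g * x ∈ powerSpan k g y n := by
  have : powerSpan k g y n ≤ (powerSpan k g y n).comap (LinearMap.mulLeft k g) := by
    refine Submodule.span_le.2 ?_
    rintro _ ⟨j, m, hm, rfl⟩
    simpa [← mul_assoc, ← pow_succ'] using pow_mul_pow_mem_powerSpan (k := k) g y (j + 1) hm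
  exact this hx

theorem mul_right_mem_powerSpan_of_forall
    (h : ∀ m < n, y ^ m * g - lam ^ m • (g * y ^ m) ∈ powerSpan k g y m) {x : A}
    (hx : x ∈ powerSpan k g y n) : x * g ∈ powerSpan k g y n := by
  have : powerSpan k g y n ≤ (powerSpan k g y n).comap (LinearMap.mulRight k g) := by
    refine Submodule.span_le.2 ?_
    rintro _ ⟨j, m, hm, rfl⟩
    have h1 : y ^ m * g ∈ powerSpan k g y n := by
      rw [← sub_add_cancel (y ^ m * g) (lam ^ m • (g * y ^ m))]
      exact add_mem (powerSpan_mono g y hm.le (h m hm))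
        (Submodule.smul_mem _ _ (mul_pow_mem_powerSpan g y hm))
    have h2 : ∀ j : ℕ, g ^ j * (y ^ m * g) ∈ powerSpan k g y n := by
      intro j
      induction j with
      | zero => simpa using h1
      | succ j ih => rw [pow_succ', mul_assoc]; exact mul_left_mem_powerSpan ih
    simpa [mul_assoc] using h2 j
  exact this hx

theorem pow_mul_sub_mem_powerSpan (h : y * g = lam • (g * y) + c • (g * (g - 1))) (n : ℕ) :
    y ^ n * g - lam ^ n • (g * y ^ n) ∈ powerSpan k g y n := by
  induction n using Nat.strong_induction_on with
  | _ n ih =>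
    cases n with
    | zero => simp
    | succ n =>
      have h0 := ih n n.lt_succ_self
      have h1 : y ^ n * g ∈ powerSpan k g y (n + 1) := by
        rw [← sub_add_cancel (y ^ n * g) (lam ^ n • (g * y ^ n))]
        exact add_mem (powerSpan_mono g y n.le_succ h0)
          (Submodule.smul_mem _ _ (mul_pow_mem_powerSpan g y n.lt_succ_self))
      have h2 : y ^ n * g * g ∈ powerSpan k g y (n + 1) :=
        mul_right_mem_powerSpan_of_forall ih h1
      have key : y ^ (n + 1) * g - lam ^ (n + 1) • (g * y ^ (n + 1)) =
          lam • ((y ^ n * g - lam ^ n • (g * y ^ n)) * y) +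
            (c • (y ^ n * g * g) - c • (y ^ n * g)) := by
        rw [pow_succ, mul_assoc, h]
        simp only [mul_add, mul_sub, sub_mul, mul_smul_comm, smul_mul_assoc, smul_sub, smul_smul,
          mul_one, mul_assoc, pow_succ']
        rw [← pow_succ, ← pow_succ']
        abel
      rw [key]
      exact add_mem (Submodule.smul_mem _ _ (mul_right_mem_powerSpan h0))
        (sub_mem (Submodule.smul_mem _ _ h2) (Submodule.smul_mem _ _ h1))

theorem mul_pow_mem_powerSpan_of_mem (h : y * g = lam • (g * y) + c • (g * (g - 1))) {x : A}
    (hx : x ∈ powerSpan k g y n) (j : ℕ) : x * g ^ j ∈ powerSpan k g y n := by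
  induction j with
  | zero => simpa using hx
  | succ j ih =>
    rw [pow_succ, ← mul_assoc]
    exact mul_right_mem_powerSpan_of_forall (fun m _ => pow_mul_sub_mem_powerSpan h m) ih

variable (k) in
/-- The span of the elements `g ^ j * (y₁ ^ a * y₂ ^ b)` with `a + b < n`. -/
def biPowerSpan (g y₁ y₂ : A) (n : ℕ) : Submodule k A :=
  Submodule.span k {x | ∃ j a b, a + b < n ∧ g ^ j * (y₁ ^ a * y₂ ^ b) = x}

theorem powerSpan_mul_powerSpan_le {y₁ y₂ : A}
    (h : y₁ * g = lam • (g * y₁) + c • (g * (g - 1))) {i j n : ℕ}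
    (hn : ∀ a < i, ∀ b < j, a + b < n) :
    powerSpan k g y₁ i * powerSpan k g y₂ j ≤ biPowerSpan k g y₁ y₂ n := by
  rw [Submodule.mul_le]
  intro x hx z hz
  have : powerSpan k g y₂ j ≤ (biPowerSpan k g y₁ y₂ n).comap (LinearMap.mulLeft k x) := by
    refine Submodule.span_le.2 ?_
    rintro _ ⟨t, b, hb, rfl⟩
    have h1 : powerSpan k g y₁ i ≤
        (biPowerSpan k g y₁ y₂ n).comap (LinearMap.mulRight k (y₂ ^ b)) := by
      refine Submodule.span_le.2 ?_
      rintro _ ⟨s, a, ha, rfl⟩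
      exact Submodule.subset_span ⟨s, a, b, hn a ha b hb, by simp [mul_assoc]⟩
    simpa [mul_assoc] using h1 (mul_pow_mem_powerSpan_of_mem h hx t)
  exact this hz

/-- The subspace `E ⊗ A` of `A ⊗ A`. -/
def tensorTop (E : Submodule k A) : Submodule k (A ⊗[k] A) :=
  Submodule.map₂ (TensorProduct.mk k A A) E ⊤

theorem tmul_mem_tensorTop {E : Submodule k A} {e : A} (he : e ∈ E) (x : A) :
    e ⊗ₜ[k] x ∈ tensorTop E :=
  Submodule.apply_mem_map₂ _ he Submodule.mem_top

theorem tensorTop_mono {E F : Submodule k A} (h : E ≤ F) : tensorTop E ≤ tensorTop F :=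
  Submodule.map₂_le_map₂_left h

theorem mul_mem_tensorTop {E F L : Submodule k A} (h : E * F ≤ L) {x z : A ⊗[k] A}
    (hx : x ∈ tensorTop E) (hz : z ∈ tensorTop F) : x * z ∈ tensorTop L := by
  refine tensorTop_mono h ?_
  have h1 : tensorTop E ≤ (tensorTop (E * F)).comap (LinearMap.mulRight k z) := by
    refine Submodule.map₂_le.2 fun e he a _ => ?_
    have h2 : tensorTop F ≤ (tensorTop (E * F)).comap (LinearMap.mulLeft k (e ⊗ₜ[k] a)) := by
      refine Submodule.map₂_le.2 fun f hf b _ => ?_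
      simpa using tmul_mem_tensorTop (Submodule.mul_mem_mul he hf) (a * b)
    exact h2 hz
  exact h1 hx

theorem map_tensor_eq_zero {E : Submodule k A} {ψ f : A →ₗ[k] k} (h : ∀ e ∈ E, ψ e = 0)
    {x : A ⊗[k] A} (hx : x ∈ tensorTop E) : TensorProduct.map ψ f x = 0 := by
  have : tensorTop E ≤ LinearMap.ker (TensorProduct.map ψ f) := by
    refine Submodule.map₂_le.2 fun e he a _ => ?_
    simp [h e he]
  exact this hx

/-- The `q`-integer `1 + q + ⋯ + q ^ (n - 1)`. -/
def qInt (q : k) (n : ℕ) : k := ∑ i ∈ Finset.range n, q ^ i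

@[simp] theorem qInt_zero (q : k) : qInt q 0 = 0 := by simp [qInt]

theorem qInt_succ (q : k) (n : ℕ) : qInt q (n + 1) = qInt q n + q ^ n :=
  Finset.sum_range_succ _ _

theorem qInt_smul_mul_pow_mem (q : k) (g y : A) (n : ℕ) :
    qInt q n • (g * y ^ (n - 1)) ∈ powerSpan k g y n := by
  cases n with
  | zero => simp
  | succ n => exact Submodule.smul_mem _ _ (mul_pow_mem_powerSpan g y n.lt_succ_self)

end PowerSpan

section SkewPrimitive

variable {k H : Type*} [Field k] [Ring H] [HopfAlgebra k H]
variable {g : GroupLike k H} {lam c c₁ c₂ : k}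

theorem comul_pow_sub_mem {y : H} (hy : y ∈ skewPrimitives g)
    (h : y * g = lam • ((g : H) * y) + c • ((g : H) * (g - 1))) (n : ℕ) :
    (Coalgebra.comul (R := k) (y ^ n)) -
      ((y ^ n) ⊗ₜ[k] (1 : H) + (qInt lam n • ((g : H) * y ^ (n - 1))) ⊗ₜ[k] y) ∈
      tensorTop (powerSpan k (g : H) y (n - 1)) := by
  have hy' : (Coalgebra.comul y : H ⊗[k] H) = y ⊗ₜ[k] 1 + (g : H) ⊗ₜ[k] y := hy
  induction n with
  | zero => simp [Algebra.TensorProduct.one_def]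
  | succ n ih =>
    rw [pow_succ, Bialgebra.comul_mul]
    set r := (Coalgebra.comul (R := k) (y ^ n)) -
      ((y ^ n) ⊗ₜ[k] (1 : H) + (qInt lam n • ((g : H) * y ^ (n - 1))) ⊗ₜ[k] y) with hr
    rw [← sub_add_cancel (Coalgebra.comul (R := k) (y ^ n))
      ((y ^ n) ⊗ₜ[k] (1 : H) + (qInt lam n • ((g : H) * y ^ (n - 1))) ⊗ₜ[k] y), ← hr, hy',
      Nat.add_sub_cancel]
    have e1 := pow_mul_sub_mem_powerSpan h n
    set e := y ^ n * (g : H) - lam ^ n • ((g : H) * y ^ n) with he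
    have hyn : y ^ n * (g : H) = e + lam ^ n • ((g : H) * y ^ n) := by rw [he]; abel
    have hq : (qInt lam n • ((g : H) * y ^ (n - 1))) * y = qInt lam n • ((g : H) * y ^ n) := by
      cases n with
      | zero => simp
      | succ n => simp [mul_assoc, ← pow_succ]
    have key : (r + ((y ^ n) ⊗ₜ[k] (1 : H) + (qInt lam n • ((g : H) * y ^ (n - 1))) ⊗ₜ[k] y)) *
          (y ⊗ₜ[k] 1 + (g : H) ⊗ₜ[k] y) -
        ((y ^ n * y) ⊗ₜ[k] (1 : H) + (qInt lam (n + 1) • ((g : H) * y ^ n)) ⊗ₜ[k] y) =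
        r * (y ⊗ₜ[k] 1) + r * ((g : H) ⊗ₜ[k] y) + e ⊗ₜ[k] y +
          (qInt lam n • ((g : H) * y ^ (n - 1)) * (g : H)) ⊗ₜ[k] (y * y) := by
      simp only [add_mul, mul_add, Algebra.TensorProduct.tmul_mul_tmul, one_mul, mul_one, hyn, hq,
        qInt_succ, add_smul, TensorProduct.add_tmul]
      abel
    rw [key]
    refine add_mem (add_mem (add_mem ?_ ?_) (tmul_mem_tensorTop e1 _)) (tmul_mem_tensorTop ?_ _)
    · refine mul_mem_tensorTop (F := k ∙ y) ?_ ih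
        (tmul_mem_tensorTop (Submodule.mem_span_singleton_self y) _)
      rw [Submodule.mul_le]
      intro x hx z hz
      obtain ⟨s, rfl⟩ := Submodule.mem_span_singleton.1 hz
      rw [mul_smul_comm]
      refine Submodule.smul_mem _ _ ?_
      cases n with
      | zero => simp [powerSpan] at hx; simp [hx]
      | succ n => exact mul_right_mem_powerSpan hx
    · refine mul_mem_tensorTop (F := k ∙ (g : H)) ?_ ih
        (tmul_mem_tensorTop (Submodule.mem_span_singleton_self (g : H)) _)
      rw [Submodule.mul_le]
      intro x hx z hz
      obtain ⟨s, rfl⟩ := Submodule.mem_span_singleton.1 hz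
      rw [mul_smul_comm]
      refine Submodule.smul_mem _ _ (powerSpan_mono _ _ (Nat.sub_le n 1) ?_)
      simpa using mul_pow_mem_powerSpan_of_mem h hx 1
    · simpa using mul_pow_mem_powerSpan_of_mem h (qInt_smul_mul_pow_mem lam (g : H) y n) 1

theorem comul_pow_mem {y : H} (hy : y ∈ skewPrimitives g)
    (h : y * g = lam • ((g : H) * y) + c • ((g : H) * (g - 1))) (n : ℕ) :
    (Coalgebra.comul (R := k) (y ^ n)) ∈ tensorTop (powerSpan k (g : H) y (n + 1)) := by
  rw [← sub_add_cancel (Coalgebra.comul (R := k) (y ^ n))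
      ((y ^ n) ⊗ₜ[k] (1 : H) + (qInt lam n • ((g : H) * y ^ (n - 1))) ⊗ₜ[k] y)]
  refine add_mem (tensorTop_mono (powerSpan_mono _ _ (by omega)) (comul_pow_sub_mem hy h n))
    (add_mem (tmul_mem_tensorTop (pow_mem_powerSpan _ _ n.lt_succ_self) _)
      (tmul_mem_tensorTop (powerSpan_mono _ _ n.le_succ (qInt_smul_mul_pow_mem _ _ _ _)) _))

theorem comul_pow_mul_pow_sub_mem {y₁ y₂ : H} (hy₁ : y₁ ∈ skewPrimitives g)
    (hy₂ : y₂ ∈ skewPrimitives g)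
    (h₁ : y₁ * g = lam • ((g : H) * y₁) + c₁ • ((g : H) * (g - 1)))
    (h₂ : y₂ * g = lam • ((g : H) * y₂) + c₂ • ((g : H) * (g - 1))) (a b : ℕ) :
    (Coalgebra.comul (R := k) (y₁ ^ a * y₂ ^ b)) -
      ((y₁ ^ a * y₂ ^ b) ⊗ₜ[k] (1 : H) +
        qInt lam a • ((g : H) * (y₁ ^ (a - 1) * y₂ ^ b)) ⊗ₜ[k] y₁ +
        (lam ^ a * qInt lam b) • ((g : H) * (y₁ ^ a * y₂ ^ (b - 1))) ⊗ₜ[k] y₂) ∈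
      tensorTop (biPowerSpan k (g : H) y₁ y₂ (a + b - 1)) := by
  have hr₁ := comul_pow_sub_mem hy₁ h₁ a
  have hr₂ := comul_pow_sub_mem hy₂ h₂ b
  have hΔ₂ := comul_pow_mem hy₂ h₂ b
  rw [Bialgebra.comul_mul]
  set d₁ := Coalgebra.comul (R := k) (y₁ ^ a)
  set d₂ := Coalgebra.comul (R := k) (y₂ ^ b)
  set s₁ := qInt lam a • ((g : H) * y₁ ^ (a - 1)) with hs₁
  set s₂ := qInt lam b • ((g : H) * y₂ ^ (b - 1)) with hs₂
  have hs₁' : s₁ ∈ powerSpan k (g : H) y₁ a := qInt_smul_mul_pow_mem _ _ _ _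
  have hs₂' : s₂ ∈ powerSpan k (g : H) y₂ b := qInt_smul_mul_pow_mem _ _ _ _
  have he := pow_mul_sub_mem_powerSpan h₁ a
  set e := y₁ ^ a * (g : H) - lam ^ a • ((g : H) * y₁ ^ a) with hedef
  have hyg : y₁ ^ a * (g : H) = e + lam ^ a • ((g : H) * y₁ ^ a) := by rw [hedef]; abel
  have hcross : y₁ ^ a * s₂ = e * (qInt lam b • y₂ ^ (b - 1)) +
      (lam ^ a * qInt lam b) • ((g : H) * (y₁ ^ a * y₂ ^ (b - 1))) := by
    rw [hs₂, mul_smul_comm, ← mul_assoc, hyg, add_mul, smul_add, smul_mul_assoc, smul_smul,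
      mul_smul_comm, mul_assoc, mul_comm (qInt lam b)]
  have key : d₁ * d₂ - ((y₁ ^ a * y₂ ^ b) ⊗ₜ[k] (1 : H) +
        qInt lam a • ((g : H) * (y₁ ^ (a - 1) * y₂ ^ b)) ⊗ₜ[k] y₁ +
        (lam ^ a * qInt lam b) • ((g : H) * (y₁ ^ a * y₂ ^ (b - 1))) ⊗ₜ[k] y₂) =
      (d₁ - ((y₁ ^ a) ⊗ₜ[k] (1 : H) + s₁ ⊗ₜ[k] y₁)) * d₂ +
      ((y₁ ^ a) ⊗ₜ[k] (1 : H) + s₁ ⊗ₜ[k] y₁) * (d₂ - ((y₂ ^ b) ⊗ₜ[k] (1 : H) + s₂ ⊗ₜ[k] y₂)) +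
      (e * (qInt lam b • y₂ ^ (b - 1))) ⊗ₜ[k] y₂ + (s₁ * s₂) ⊗ₜ[k] (y₁ * y₂) := by
    have hmul : ((y₁ ^ a) ⊗ₜ[k] (1 : H) + s₁ ⊗ₜ[k] y₁) * ((y₂ ^ b) ⊗ₜ[k] (1 : H) + s₂ ⊗ₜ[k] y₂) =
        (y₁ ^ a * y₂ ^ b) ⊗ₜ[k] (1 : H) +
        qInt lam a • ((g : H) * (y₁ ^ (a - 1) * y₂ ^ b)) ⊗ₜ[k] y₁ +
        (lam ^ a * qInt lam b) • ((g : H) * (y₁ ^ a * y₂ ^ (b - 1))) ⊗ₜ[k] y₂ +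
        (e * (qInt lam b • y₂ ^ (b - 1))) ⊗ₜ[k] y₂ + (s₁ * s₂) ⊗ₜ[k] (y₁ * y₂) := by
      have hs₁m : s₁ * y₂ ^ b = qInt lam a • ((g : H) * (y₁ ^ (a - 1) * y₂ ^ b)) := by
        rw [hs₁, smul_mul_assoc, mul_assoc]
      simp only [add_mul, mul_add, Algebra.TensorProduct.tmul_mul_tmul, one_mul, mul_one, hcross,
        hs₁m, TensorProduct.add_tmul, TensorProduct.smul_tmul']
      abel
    rw [sub_mul, mul_sub, hmul]
    abel
  rw [key]
  have hP₁ : (y₁ ^ a) ⊗ₜ[k] (1 : H) + s₁ ⊗ₜ[k] y₁ ∈ tensorTop (powerSpan k (g : H) y₁ (a + 1)) :=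
    add_mem (tmul_mem_tensorTop (pow_mem_powerSpan _ _ a.lt_succ_self) _)
      (tmul_mem_tensorTop (powerSpan_mono _ _ a.le_succ hs₁') _)
  refine add_mem (add_mem (add_mem ?_ ?_) (tmul_mem_tensorTop ?_ _)) (tmul_mem_tensorTop ?_ _)
  · exact mul_mem_tensorTop (powerSpan_mul_powerSpan_le h₁ (by omega)) hr₁ hΔ₂
  · exact mul_mem_tensorTop (powerSpan_mul_powerSpan_le h₁ (by omega)) hP₁ hr₂
  · refine powerSpan_mul_powerSpan_le h₁ (i := a) (j := b) (by omega)
      (Submodule.mul_mem_mul he ?_)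
    cases b with
    | zero => simp
    | succ b => exact Submodule.smul_mem _ _ (pow_mem_powerSpan _ _ (by omega))
  · exact powerSpan_mul_powerSpan_le h₁ (by omega) (Submodule.mul_mem_mul hs₁' hs₂')

end SkewPrimitive

section Independence

variable {k H : Type*} [Field k] [Ring H] [HopfAlgebra k H]
variable {g : GroupLike k H} {lam c₁ c₂ : k}

theorem map_comul_mul_pow_mul_pow {y₁ y₂ : H} (hy₁ : y₁ ∈ skewPrimitives g)
    (hy₂ : y₂ ∈ skewPrimitives g)
    (h₁ : y₁ * g = lam • ((g : H) * y₁) + c₁ • ((g : H) * (g - 1)))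
    (h₂ : y₂ * g = lam • ((g : H) * y₂) + c₂ • ((g : H) * (g - 1))) {a b : ℕ}
    {ψ f : H →ₗ[k] k} (h : GroupLike k H) (hf : f h = 0)
    (hψ : ∀ (x : GroupLike k H) (i j : ℕ), i + j < a + b - 1 →
      ψ (x * (y₁ ^ i * y₂ ^ j)) = 0) :
    LinearMap.mul' k k (TensorProduct.map ψ f (Coalgebra.comul (h * (y₁ ^ a * y₂ ^ b)))) =
      qInt lam a * ψ ((h * g : GroupLike k H) * (y₁ ^ (a - 1) * y₂ ^ b)) * f (h * y₁) +
      lam ^ a * qInt lam b * ψ ((h * g : GroupLike k H) * (y₁ ^ a * y₂ ^ (b - 1))) *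
        f (h * y₂) := by
  have hr := comul_pow_mul_pow_sub_mem hy₁ hy₂ h₁ h₂ a b
  set M := (y₁ ^ a * y₂ ^ b) ⊗ₜ[k] (1 : H) +
        qInt lam a • ((g : H) * (y₁ ^ (a - 1) * y₂ ^ b)) ⊗ₜ[k] y₁ +
        (lam ^ a * qInt lam b) • ((g : H) * (y₁ ^ a * y₂ ^ (b - 1))) ⊗ₜ[k] y₂ with hM
  set r := Coalgebra.comul (R := k) (y₁ ^ a * y₂ ^ b) - M
  have hΔ : Coalgebra.comul (R := k) (y₁ ^ a * y₂ ^ b) = r + M := by simp [r]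
  have h0 : TensorProduct.map ψ f (((h : H) ⊗ₜ[k] (h : H)) * r) = 0 := by
    refine map_tensor_eq_zero
      (E := (biPowerSpan k (g : H) y₁ y₂ (a + b - 1)).map (LinearMap.mulLeft k (h : H))) ?_
      (mul_mem_tensorTop (E := k ∙ (h : H)) ?_
        (tmul_mem_tensorTop (Submodule.mem_span_singleton_self _) _) hr)
    · rintro _ ⟨x, hx, rfl⟩
      have : biPowerSpan k (g : H) y₁ y₂ (a + b - 1) ≤
          LinearMap.ker (ψ ∘ₗ LinearMap.mulLeft k (h : H)) := by
        refine Submodule.span_le.2 ?_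
        rintro _ ⟨t, i, j, hij, rfl⟩
        have := hψ (h * g ^ t) i j hij
        simpa [mul_assoc] using this
      exact this hx
    · rw [Submodule.mul_le]
      intro x hx z hz
      obtain ⟨s, rfl⟩ := Submodule.mem_span_singleton.1 hx
      rw [smul_mul_assoc]
      exact Submodule.smul_mem _ _ ⟨z, hz, rfl⟩
  rw [Bialgebra.comul_mul, h.2.comul_eq_tmul_self, hΔ, mul_add, map_add, h0, zero_add, hM]
  simp only [mul_add, map_add, mul_smul_comm, map_smul, Algebra.TensorProduct.tmul_mul_tmul,
    TensorProduct.map_tmul, LinearMap.mul'_apply, mul_one, hf, mul_zero, zero_add, smul_eq_mul,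
    GroupLike.val_mul, mul_assoc]

open scoped Classical in
theorem exists_dual_groupLike (h₀ : GroupLike k H) :
    ∃ F : H →ₗ[k] k, ∀ h : GroupLike k H, F h = if h = h₀ then 1 else 0 := by
  have hli : LinearIndependent k (GroupLike.val (R := k) (A := H)) := linearIndep_groupLikeVal
  obtain ⟨F, hF⟩ := LinearMap.exists_extend (Finsupp.lapply h₀ ∘ₗ hli.repr)
  refine ⟨F, fun h => ?_⟩
  have h1 := LinearMap.congr_fun hF ⟨h, Submodule.subset_span ⟨h, rfl⟩⟩
  have h2 := hli.repr_eq_single h ⟨h, Submodule.subset_span ⟨h, rfl⟩⟩ rfl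
  simp only [LinearMap.comp_apply, h2, Submodule.subtype_apply,
    Finsupp.lapply_apply, Finsupp.single_apply] at h1
  exact h1

theorem exists_dual_skewPrimitive {C : Submodule k H} (hC : ∀ h : GroupLike k H, (h : H) ∈ C)
    {y₁ y₂ : H} (hind : ∀ s : k, y₁ - s • y₂ ∉ C) (h₀ : GroupLike k H) :
    ∃ f : H →ₗ[k] k, (∀ h : GroupLike k H, f h = 0) ∧ f (h₀ * y₁) = 1 ∧ f (h₀ * y₂) = 0 := by
  have hnot : y₁ ∉ C ⊔ k ∙ y₂ := by
    intro hm
    obtain ⟨u, hu, v, hv, huv⟩ := Submodule.mem_sup.1 hm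
    obtain ⟨s, rfl⟩ := Submodule.mem_span_singleton.1 hv
    refine hind s ?_
    rw [← huv, add_sub_cancel_right]
    exact hu
  obtain ⟨f, hf, hle⟩ := Submodule.exists_le_ker_of_notMem hnot
  refine ⟨(f y₁)⁻¹ • f ∘ₗ LinearMap.mulLeft k ((h₀⁻¹ : GroupLike k H) : H), fun h => ?_, ?_, ?_⟩
  · have : f ((h₀⁻¹ * h : GroupLike k H) : H) = 0 := hle (le_sup_left (a := C) (hC _))
    rw [GroupLike.val_mul] at this
    simp only [LinearMap.smul_apply, LinearMap.comp_apply, LinearMap.mulLeft_apply, this, smul_zero]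
  · simp [← mul_assoc, hf]
  · have : f y₂ = 0 := hle (le_sup_right (a := C) (Submodule.mem_span_singleton_self _))
    simp [← mul_assoc, this]

open scoped Classical in
theorem exists_dual_monomial {C : Submodule k H} (hC : ∀ h : GroupLike k H, (h : H) ∈ C)
    {y₁ y₂ : H} (hy₁ : y₁ ∈ skewPrimitives g) (hy₂ : y₂ ∈ skewPrimitives g)
    (h₁ : y₁ * g = lam • ((g : H) * y₁) + c₁ • ((g : H) * (g - 1)))
    (h₂ : y₂ * g = lam • ((g : H) * y₂) + c₂ • ((g : H) * (g - 1)))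
    (hq : ∀ n, qInt lam (n + 1) ≠ 0)
    (hind₁ : ∀ s : k, y₁ - s • y₂ ∉ C) (hind₂ : ∀ s : k, y₂ - s • y₁ ∉ C)
    (a b : ℕ) (h₀ : GroupLike k H) :
    ∃ F : H →ₗ[k] k, ∀ (h : GroupLike k H) (i j : ℕ), i + j ≤ a + b →
      F (h * (y₁ ^ i * y₂ ^ j)) = if h = h₀ ∧ i = a ∧ j = b then 1 else 0 := by
  induction hn : a + b generalizing a b h₀ with
  | zero =>
    obtain ⟨F, hF⟩ := exists_dual_groupLike h₀
    refine ⟨F, fun h i j hij => ?_⟩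
    obtain rfl : i = 0 := by omega
    obtain rfl : j = 0 := by omega
    obtain rfl : a = 0 := by omega
    obtain rfl : b = 0 := by omega
    simpa using hF h
  | succ n ih =>
    rcases a with _ | a
    · obtain ⟨b, rfl⟩ : ∃ m, b = m + 1 := ⟨n, by omega⟩
      obtain ⟨ψ, hψ⟩ := ih 0 b (h₀ * g) (by omega)
      obtain ⟨f, hf, hf₂, hf₁⟩ := exists_dual_skewPrimitive hC hind₂ h₀
      refine ⟨(qInt lam (b + 1))⁻¹ • LinearMap.mul' k k ∘ₗ TensorProduct.map ψ f ∘ₗ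
        Coalgebra.comul, fun h i j hij => ?_⟩
      rw [LinearMap.smul_apply, LinearMap.comp_apply, LinearMap.comp_apply,
        map_comul_mul_pow_mul_pow hy₁ hy₂ h₁ h₂ h (hf h) ?_]
      · rcases i with _ | i
        · rcases j with _ | j
          · simp
          · rw [Nat.add_sub_cancel, hψ (h * g) 0 j (by omega)]
            by_cases hh : h = h₀ ∧ j = b
            · obtain ⟨rfl, rfl⟩ := hh
              simp [hf₂, hq]
            · simp [hh]
        · rw [Nat.add_sub_cancel, hψ (h * g) i j (by omega)]
          have h3 : ¬ (h = h₀ ∧ i + 1 = 0 ∧ j = b + 1) := by omega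
          rw [if_neg h3]
          have h4 : qInt lam j *
              ψ ((h * g : GroupLike k H) * (y₁ ^ (i + 1) * y₂ ^ (j - 1))) = 0 := by
            rcases j with _ | j
            · simp
            · rw [hψ _ _ _ (by omega), if_neg (by omega), mul_zero]
          rw [mul_assoc (lam ^ (i + 1)), h4]
          by_cases hh : h = h₀
          · subst hh; simp [hf₁]
          · simp [hh]
      · intro x i' j' hij'
        rw [hψ _ _ _ (by omega), if_neg (by omega)]
    · obtain ⟨ψ, hψ⟩ := ih a b (h₀ * g) (by omega)
      obtain ⟨f, hf, hf₁, hf₂⟩ := exists_dual_skewPrimitive hC hind₁ h₀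
      refine ⟨(qInt lam (a + 1))⁻¹ • LinearMap.mul' k k ∘ₗ TensorProduct.map ψ f ∘ₗ
        Coalgebra.comul, fun h i j hij => ?_⟩
      rw [LinearMap.smul_apply, LinearMap.comp_apply, LinearMap.comp_apply,
        map_comul_mul_pow_mul_pow hy₁ hy₂ h₁ h₂ h (hf h) ?_]
      · have h4 : lam ^ i * qInt lam j *
            ψ ((h * g : GroupLike k H) * (y₁ ^ i * y₂ ^ (j - 1))) * f (h * y₂) = 0 := by
          rcases j with _ | j
          · simp
          · rw [hψ _ _ _ (by omega)]
            by_cases hh : h = h₀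
            · subst hh; simp [hf₂]
            · simp [hh]
        rw [h4, add_zero]
        rcases i with _ | i
        · simp
        · rw [Nat.add_sub_cancel, hψ (h * g) i j (by omega)]
          by_cases hh : h = h₀ ∧ i = a ∧ j = b
          · obtain ⟨rfl, rfl, rfl⟩ := hh
            simp [hf₁, hq]
          · simp [hh]
      · intro x i' j' hij'
        rw [hψ _ _ _ (by omega), if_neg (by omega)]

open scoped Classical in
theorem eq_zero_of_sum_monomial_eq_zero {y₁ y₂ : H}
    (hdual : ∀ (a b : ℕ) (h₀ : GroupLike k H), ∃ F : H →ₗ[k] k,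
      ∀ (h : GroupLike k H) (i j : ℕ), i + j ≤ a + b →
        F (h * (y₁ ^ i * y₂ ^ j)) = if h = h₀ ∧ i = a ∧ j = b then 1 else 0)
    (s : Finset (ℕ × ℕ)) (u : ℕ × ℕ → H)
    (hu : ∀ p, u p ∈ Submodule.span k (Set.range (GroupLike.val (R := k) (A := H))))
    (hsum : ∑ p ∈ s, u p * (y₁ ^ p.1 * y₂ ^ p.2) = 0) : ∀ p ∈ s, u p = 0 := by
  by_contra! hne
  obtain ⟨p₀, hp₀, hmax⟩ := Finset.exists_max_image (s.filter fun p => u p ≠ 0)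
    (fun p => p.1 + p.2) (by
      obtain ⟨p, hp, hp'⟩ := hne
      exact ⟨p, Finset.mem_filter.2 ⟨hp, hp'⟩⟩)
  rw [Finset.mem_filter] at hp₀
  refine hp₀.2 ?_
  obtain ⟨l, hl⟩ := (Finsupp.mem_span_range_iff_exists_finsupp).1 (hu p₀)
  have hl0 : l = 0 := by
    ext h₀
    obtain ⟨F, hF⟩ := hdual p₀.1 p₀.2 h₀
    have hz : ∀ p ∈ s, p ≠ p₀ → F (u p * (y₁ ^ p.1 * y₂ ^ p.2)) = 0 := by
      intro p hp hpp
      by_cases hup : u p = 0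
      · simp [hup]
      · have hdeg := hmax p (Finset.mem_filter.2 ⟨hp, hup⟩)
        have : Submodule.span k (Set.range (GroupLike.val (R := k) (A := H))) ≤
            LinearMap.ker (F ∘ₗ LinearMap.mulRight k (y₁ ^ p.1 * y₂ ^ p.2)) := by
          refine Submodule.span_le.2 ?_
          rintro _ ⟨h, rfl⟩
          have := hF h p.1 p.2 hdeg
          rw [if_neg (fun hh => hpp (Prod.ext hh.2.1 hh.2.2))] at this
          exact this
        exact this (hu p)
    have h1 := congrArg F hsum
    rw [map_sum, Finset.sum_eq_single_of_mem p₀ hp₀.1 hz, ← hl, map_zero, Finsupp.sum,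
      Finset.sum_mul, map_sum] at h1
    simp only [smul_mul_assoc, map_smul, hF _ _ _ le_rfl, and_self, and_true, smul_eq_mul,
      mul_ite, mul_one, mul_zero, Finset.sum_ite_eq', Finsupp.mem_support_iff] at h1
    simpa using h1
  rw [← hl, hl0, Finsupp.sum_zero_index]

theorem setOf_isGroupLikeElem_eq_range :
    {x : H | IsGroupLikeElem k x} = Set.range (GroupLike.val (R := k) (A := H)) :=
  Set.ext fun x => ⟨fun hx => ⟨⟨x, hx⟩, rfl⟩, by rintro ⟨h, rfl⟩; exact h.2⟩

/-- Two skew primitive elements of the same weight and the same commutator `lam`, independent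
modulo the coradical, raise the Gelfand–Kirillov dimension by two, unless `lam` is a nontrivial
root of unity. -/
theorem gkDim_coradicalSubalgebra_add_two_le (hpt : IsPointed k H) {y₁ y₂ : H}
    (hy₁ : y₁ ∈ skewPrimitives g) (hy₂ : y₂ ∈ skewPrimitives g)
    (h₁ : y₁ * g = lam • ((g : H) * y₁) + c₁ • ((g : H) * (g - 1)))
    (h₂ : y₂ * g = lam • ((g : H) * y₂) + c₂ • ((g : H) * (g - 1)))
    (hq : ∀ n, qInt lam (n + 1) ≠ 0)
    (hind₁ : ∀ s : k, y₁ - s • y₂ ∉ coradical k H)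
    (hind₂ : ∀ s : k, y₂ - s • y₁ ∉ coradical k H) :
    gkDim k (coradicalSubalgebra k H) + 2 ≤ gkDim k H := by
  have hspan : coradical k H = Submodule.span k (Set.range (GroupLike.val (R := k) (A := H))) := by
    rw [hpt.coradical_eq_span, setOf_isGroupLikeElem_eq_range]
  have : Nontrivial H := by
    refine ⟨y₁, 0, ?_⟩
    rintro rfl
    exact hind₁ 0 (by simp)
  refine gkDim_add_two_le _ y₁ y₂ fun s u hu => ?_
  refine eq_zero_of_sum_monomial_eq_zero (fun a b h₀ => exists_dual_monomial (C := coradical k H)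
    (fun h => ?_) hy₁ hy₂ h₁ h₂ hq hind₁ hind₂ a b h₀) s u fun p => ?_
  · rw [hspan]
    exact Submodule.subset_span ⟨h, rfl⟩
  · rw [← hspan, ← hpt.toSubmodule_coradicalSubalgebra]
    exact hu p

end Independence

section Algebra

variable {k A : Type*} [Field k] [Ring A] [Algebra k A]

theorem exists_algebraMap_eq_of_pow_eq [IsAlgClosed k] [IsDomain A] {x : A} {n : ℕ} (hn : 0 < n) {c : k}
    (h : x ^ n = algebraMap k A c) : ∃ r : k, algebraMap k A r = x := by
  have hx : IsIntegral k x :=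
    ⟨Polynomial.X ^ n - Polynomial.C c, Polynomial.monic_X_pow_sub_C c hn.ne', by simp [h]⟩
  exact minpoly.mem_range_of_degree_eq_one k x
    (IsAlgClosed.degree_eq_one_of_irreducible k (minpoly.irreducible hx))

theorem exists_polynomial_eval_eq_apply_add_smul_pow (x y : A) (n : ℕ) (φ : A →ₗ[k] k) :
    ∃ p : Polynomial k, (∀ t : k, φ ((x + t • y) ^ n) = p.eval t) ∧ p.natDegree ≤ n ∧
      p.coeff n = φ (y ^ n) := by
  induction n generalizing φ with
  | zero => exact ⟨Polynomial.C (φ 1), by simp, by simp, by simp⟩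
  | succ n ih =>
    obtain ⟨p₁, h₁, d₁, -⟩ := ih (φ ∘ₗ LinearMap.mulLeft k x)
    obtain ⟨p₂, h₂, d₂, c₂⟩ := ih (φ ∘ₗ LinearMap.mulLeft k y)
    refine ⟨p₁ + Polynomial.X * p₂, fun t => ?_, ?_, ?_⟩
    · rw [pow_succ', add_mul, map_add, smul_mul_assoc, map_smul, smul_eq_mul]
      have e₁ := h₁ t
      have e₂ := h₂ t
      simp only [LinearMap.comp_apply, LinearMap.mulLeft_apply] at e₁ e₂
      simp [e₁, e₂]
    · refine (Polynomial.natDegree_add_le _ _).trans (max_le (by omega) ?_)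
      refine Polynomial.natDegree_mul_le.trans ?_
      have := Polynomial.natDegree_X_le (R := k)
      omega
    · rw [Polynomial.coeff_add, Polynomial.coeff_eq_zero_of_natDegree_lt (by omega), zero_add,
        Polynomial.coeff_X_mul, c₂, pow_succ']
      rfl

theorem exists_apply_add_smul_pow_eq_zero [IsAlgClosed k] (x y : A) {n : ℕ} (hn : 0 < n) (φ : A →ₗ[k] k)
    (h : φ (y ^ n) ≠ 0) : ∃ t : k, φ ((x + t • y) ^ n) = 0 := by
  obtain ⟨p, hp, -, hc⟩ := exists_polynomial_eval_eq_apply_add_smul_pow x y n φ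
  have hdeg : p.degree ≠ 0 := by
    have := Polynomial.le_degree_of_ne_zero (hc ▸ h)
    intro h0
    rw [h0] at this
    exact hn.not_ge (by exact_mod_cast this)
  obtain ⟨t, ht⟩ := IsAlgClosed.exists_root p hdeg
  exact ⟨t, (hp t).trans ht⟩

end Algebra

section SkewPrimitive

variable {k H : Type*} [Field k] [Ring H] [HopfAlgebra k H]
variable {g : GroupLike k H} {lam c₁ c₂ : k}

theorem groupLike_mem_coradical (h : GroupLike k H) : (h : H) ∈ coradical k H :=
  (le_sSup (isSimpleSubcoalgebra_span_singleton h.2) : (k ∙ (h : H)) ≤ coradical k H)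
    (Submodule.mem_span_singleton_self _)

theorem sub_one_mem_skewPrimitives (g : GroupLike k H) : (g : H) - 1 ∈ skewPrimitives g := by
  change Coalgebra.comul (R := k) ((g : H) - 1) = _
  rw [map_sub, g.2.comul_eq_tmul_self, Bialgebra.comul_one, TensorProduct.sub_tmul,
    TensorProduct.tmul_sub, Algebra.TensorProduct.one_def]
  abel

theorem sub_one_mem_coradical (g : GroupLike k H) : (g : H) - 1 ∈ coradical k H :=
  sub_mem (groupLike_mem_coradical g) (groupLike_mem_coradical (1 : GroupLike k H))

/-- The skew primitive elements in the coradical are the trivial ones. -/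
theorem exists_eq_smul_sub_one (hpt : IsPointed k H) {x : H} (hx : x ∈ skewPrimitives g)
    (hxC : x ∈ coradical k H) : ∃ c : k, x = c • ((g : H) - 1) := by
  classical
  obtain ⟨f, hf⟩ := exists_dual_groupLike (k := k) (1 : GroupLike k H)
  have hspan : coradical k H ≤ LinearMap.eqLocus
      ((TensorProduct.rid k H).toLinearMap ∘ₗ TensorProduct.map LinearMap.id f ∘ₗ Coalgebra.comul)
      (f.smulRight (1 : H)) := by
    rw [hpt.coradical_eq_span, setOf_isGroupLikeElem_eq_range]
    refine Submodule.span_le.2 ?_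
    rintro _ ⟨h, rfl⟩
    change TensorProduct.rid k H (TensorProduct.map LinearMap.id f (Coalgebra.comul (h : H))) =
      f h • (1 : H)
    rw [h.2.comul_eq_tmul_self, TensorProduct.map_tmul, TensorProduct.rid_tmul, hf h]
    by_cases hh : h = 1
    · simp [hh]
    · simp [hh]
  have h1 : TensorProduct.rid k H (TensorProduct.map LinearMap.id f (Coalgebra.comul x)) =
      f x • (1 : H) := hspan hxC
  have hx' : (Coalgebra.comul x : H ⊗[k] H) = x ⊗ₜ[k] 1 + (g : H) ⊗ₜ[k] x := hx
  have hf1 : f 1 = 1 := by simpa using hf 1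
  rw [hx', map_add, map_add, TensorProduct.map_tmul, TensorProduct.map_tmul,
    TensorProduct.rid_tmul, TensorProduct.rid_tmul, hf1, one_smul, LinearMap.id_apply,
    LinearMap.id_apply] at h1
  refine ⟨-f x, ?_⟩
  rw [neg_smul, smul_sub, neg_sub]
  exact eq_sub_of_add_eq h1

theorem invConj_mem_skewPrimitives {y : H} (hy : y ∈ skewPrimitives g) :
    invConj g y ∈ skewPrimitives g := by
  have hy' : (Coalgebra.comul y : H ⊗[k] H) = y ⊗ₜ[k] 1 + (g : H) ⊗ₜ[k] y := hy
  have hinv : ((g⁻¹ : GroupLike k H) : H) * (g : H) = 1 := by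
    rw [← GroupLike.val_mul, inv_mul_cancel, GroupLike.val_one]
  change Coalgebra.comul (R := k) (((g⁻¹ : GroupLike k H) : H) * (y * (g : H))) =
    (((g⁻¹ : GroupLike k H) : H) * (y * (g : H))) ⊗ₜ[k] 1 +
      (g : H) ⊗ₜ[k] (((g⁻¹ : GroupLike k H) : H) * (y * (g : H)))
  rw [Bialgebra.comul_mul, Bialgebra.comul_mul, hy', g.2.comul_eq_tmul_self,
    (g⁻¹).2.comul_eq_tmul_self]
  simp only [add_mul, mul_add, Algebra.TensorProduct.tmul_mul_tmul, one_mul, hinv]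
  rw [← mul_assoc _ (g : H) (g : H), hinv, one_mul]

theorem exists_mul_eq_of_mem (hpt : IsPointed k H) {y : H}
    (hy : y ∈ skewPrimitivesWithCommutator g lam 1) :
    ∃ c : k, y * g = lam • ((g : H) * y) + c • ((g : H) * (g - 1)) := by
  obtain ⟨hy₁, hy₂⟩ := hy
  have hC : invConj g y - lam • y ∈ coradical k H := by simpa using hy₂
  obtain ⟨c, hc⟩ := exists_eq_smul_sub_one hpt
    (sub_mem (invConj_mem_skewPrimitives hy₁) (Submodule.smul_mem _ lam hy₁)) hC
  refine ⟨c, ?_⟩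
  have hinv : (g : H) * ((g⁻¹ : GroupLike k H) : H) = 1 := by
    rw [← GroupLike.val_mul, mul_inv_cancel, GroupLike.val_one]
  have h1 : y * (g : H) = g * invConj g y := by
    change _ = (g : H) * (((g⁻¹ : GroupLike k H) : H) * (y * (g : H)))
    rw [← mul_assoc, hinv, one_mul]
  rw [h1, eq_add_of_sub_eq hc, mul_add, mul_smul_comm, mul_smul_comm, add_comm]

/-- A skew primitive element with commutator `lam ≠ 1` can be corrected by a trivial one so that
it `lam`-commutes with its weight. -/
theorem exists_add_smul_mul_eq {y : H} {c : k} (hlam : lam ≠ 1)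
    (h : y * g = lam • ((g : H) * y) + c • ((g : H) * (g - 1))) :
    ∃ s : k, (y + s • ((g : H) - 1)) * g = lam • ((g : H) * (y + s • ((g : H) - 1))) := by
  have hl : lam - 1 ≠ 0 := sub_ne_zero.2 hlam
  refine ⟨c / (lam - 1), ?_⟩
  have hcomm : ((g : H) - 1) * g = g * (g - 1) := by noncomm_ring
  rw [add_mul, h, smul_mul_assoc, hcomm, mul_add, mul_smul_comm, smul_add, smul_smul, add_assoc,
    ← add_smul]
  congr 2
  field_simp
  ring

theorem pow_mem_skewPrimitives {n : ℕ} (hn : 0 < n) (hlam : IsPrimitiveRoot lam n) {y : H}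
    (hy : y ∈ skewPrimitives g) (h : y * g = lam • ((g : H) * y)) :
    y ^ n ∈ skewPrimitives (g ^ n) := by
  have hy' : (Coalgebra.comul y : H ⊗[k] H) = y ⊗ₜ[k] 1 + (g : H) ⊗ₜ[k] y := hy
  change Coalgebra.comul (R := k) (y ^ n) = (y ^ n) ⊗ₜ[k] 1 +
    ((g ^ n : GroupLike k H) : H) ⊗ₜ[k] (y ^ n)
  rw [Bialgebra.comul_pow, hy', add_pow_of_isPrimitiveRoot hn hlam]
  · simp [Algebra.TensorProduct.tmul_pow]
  · simp [h, TensorProduct.smul_tmul']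

theorem pow_mul_pow_eq {n : ℕ} (hlam : IsPrimitiveRoot lam n) {y : H}
    (h : y * g = lam • ((g : H) * y)) :
    y ^ n * ((g ^ n : GroupLike k H) : H) = ((g ^ n : GroupLike k H) : H) * y ^ n := by
  have h1 := pow_mul_of_mul_eq_smul_mul h n
  rw [hlam.pow_eq_one, one_smul] at h1
  rw [GroupLike.val_pow]
  exact (show Commute (y ^ n) (g : H) from h1).pow_right n

/-- In a domain, the `n`-th power of a nontrivial skew primitive element is nontrivial. -/
theorem mem_coradical_of_pow_mem [IsAlgClosed k] [IsDomain H] (hpt : IsPointed k H) {n : ℕ}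
    (hn : 0 < n) (hlam : IsPrimitiveRoot lam n) {y : H}
    (hy : y ∈ skewPrimitives g) (h : y * g = lam • ((g : H) * y))
    (hyn : y ^ n ∈ coradical k H) : y ∈ coradical k H := by
  obtain ⟨c, hc⟩ := exists_eq_smul_sub_one hpt (pow_mem_skewPrimitives hn hlam hy h) hyn
  obtain ⟨α, hα⟩ := IsAlgClosed.exists_pow_nat_eq (-c) hn
  have hcomm : y * (α • (g : H)) = lam • ((α • (g : H)) * y) := by
    rw [mul_smul_comm, h, smul_mul_assoc, smul_comm]
  have hpow : (y + α • (g : H)) ^ n = algebraMap k H (-c) := by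
    rw [add_pow_of_isPrimitiveRoot hn hlam hcomm, hc, smul_pow, hα, GroupLike.val_pow,
      Algebra.algebraMap_eq_smul_one]
    simp only [smul_sub, neg_smul]
    abel
  obtain ⟨r, hr⟩ := exists_algebraMap_eq_of_pow_eq hn hpow
  rw [eq_sub_of_add_eq hr.symm, Algebra.algebraMap_eq_smul_one]
  exact sub_mem (Submodule.smul_mem _ _ (groupLike_mem_coradical (1 : GroupLike k H)))
    (Submodule.smul_mem _ _ (groupLike_mem_coradical g))

theorem exists_sub_smul_mem_of_qInt_ne_zero (hpt : IsPointed k H)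
    (hlt : gkDim k H < gkDim k (coradicalSubalgebra k H) + 2) {y₁ y₂ : H}
    (hy₁ : y₁ ∈ skewPrimitives g) (hy₂ : y₂ ∈ skewPrimitives g)
    (h₁ : y₁ * g = lam • ((g : H) * y₁) + c₁ • ((g : H) * (g - 1)))
    (h₂ : y₂ * g = lam • ((g : H) * y₂) + c₂ • ((g : H) * (g - 1)))
    (hq : ∀ n, qInt lam (n + 1) ≠ 0) (hy₁C : y₁ ∉ coradical k H) :
    ∃ s : k, y₂ - s • y₁ ∈ coradical k H := by
  by_contra! hne
  refine hlt.not_ge (gkDim_coradicalSubalgebra_add_two_le hpt hy₁ hy₂ h₁ h₂ hq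
    (fun s hs => ?_) hne)
  have hs0 : s ≠ 0 := by
    rintro rfl
    exact hy₁C (by simpa using hs)
  refine hne s⁻¹ ?_
  have := Submodule.smul_mem _ (-s⁻¹) hs
  rw [smul_sub, smul_smul, neg_mul, inv_mul_cancel₀ hs0, neg_smul, neg_smul, one_smul,
    sub_neg_eq_add, neg_add_eq_sub] at this
  exact this

theorem sub_one_mul_qInt (q : k) (n : ℕ) : (q - 1) * qInt q n = q ^ n - 1 :=
  mul_geom_sum q n

theorem qInt_one_succ_ne_zero [CharZero k] (n : ℕ) : qInt (1 : k) (n + 1) ≠ 0 := by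
  simpa [qInt] using Nat.cast_add_one_ne_zero (R := k) n

theorem exists_sub_smul_mem_of_isPrimitiveRoot [IsAlgClosed k] [CharZero k] [IsDomain H]
    (hpt : IsPointed k H)
    (hlt : gkDim k H < gkDim k (coradicalSubalgebra k H) + 2) {n : ℕ} (hn : 0 < n)
    (hlam : IsPrimitiveRoot lam n) {y₁ y₂ : H}
    (hy₁ : y₁ ∈ skewPrimitives g) (hy₂ : y₂ ∈ skewPrimitives g)
    (h₁ : y₁ * g = lam • ((g : H) * y₁)) (h₂ : y₂ * g = lam • ((g : H) * y₂))
    (hy₁C : y₁ ∉ coradical k H) : ∃ s : k, y₂ - s • y₁ ∈ coradical k H := by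
  have hz : y₁ ^ n ∉ coradical k H := fun h =>
    hy₁C (mem_coradical_of_pow_mem hpt hn hlam hy₁ h₁ h)
  obtain ⟨φ, hφ, hle⟩ := Submodule.exists_le_ker_of_notMem hz
  obtain ⟨t, ht⟩ := exists_apply_add_smul_pow_eq_zero y₂ y₁ hn φ hφ
  have hw : y₂ + t • y₁ ∈ skewPrimitives g := add_mem hy₂ (Submodule.smul_mem _ t hy₁)
  have hwg : (y₂ + t • y₁) * g = lam • ((g : H) * (y₂ + t • y₁)) := by
    rw [add_mul, mul_add, smul_mul_assoc, h₁, h₂, mul_smul_comm, smul_add, smul_comm]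
  obtain ⟨s, hs⟩ := exists_sub_smul_mem_of_qInt_ne_zero (g := g ^ n) (lam := 1) (c₁ := 0)
    (c₂ := 0) hpt hlt (pow_mem_skewPrimitives hn hlam hy₁ h₁)
    (pow_mem_skewPrimitives hn hlam hw hwg) (by rw [pow_mul_pow_eq hlam h₁]; simp)
    (by rw [pow_mul_pow_eq hlam hwg]; simp) qInt_one_succ_ne_zero hz
  have hs0 : s = 0 := by
    have h0 : φ ((y₂ + t • y₁) ^ n - s • y₁ ^ n) = 0 := hle hs
    rw [map_sub, ht, map_smul, zero_sub, neg_eq_zero, smul_eq_mul] at h0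
    exact (mul_eq_zero.1 h0).resolve_right hφ
  rw [hs0, zero_smul, sub_zero] at hs
  refine ⟨-t, ?_⟩
  rw [neg_smul, sub_neg_eq_add]
  exact mem_coradical_of_pow_mem hpt hn hlam hw hwg hs

theorem exists_sub_smul_mem [IsAlgClosed k] [CharZero k] [IsDomain H] (hpt : IsPointed k H)
    (hlt : gkDim k H < gkDim k (coradicalSubalgebra k H) + 2) {y₁ y₂ : H}
    (hy₁ : y₁ ∈ skewPrimitivesWithCommutator g lam 1)
    (hy₂ : y₂ ∈ skewPrimitivesWithCommutator g lam 1) (hy₁C : y₁ ∉ coradical k H) :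
    ∃ s : k, y₂ - s • y₁ ∈ coradical k H := by
  obtain ⟨c₁, h₁⟩ := exists_mul_eq_of_mem hpt hy₁
  obtain ⟨c₂, h₂⟩ := exists_mul_eq_of_mem hpt hy₂
  by_cases hq : ∀ n, qInt lam (n + 1) ≠ 0
  · exact exists_sub_smul_mem_of_qInt_ne_zero hpt hlt hy₁.1 hy₂.1 h₁ h₂ hq hy₁C
  · push Not at hq
    obtain ⟨m, hm⟩ := hq
    have hlam1 : lam ≠ 1 := by
      rintro rfl
      exact qInt_one_succ_ne_zero m hm
    have hpow : lam ^ (m + 1) = 1 := by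
      have := sub_one_mul_qInt lam (m + 1)
      rw [hm, mul_zero] at this
      exact sub_eq_zero.1 this.symm
    obtain ⟨s₁, hs₁⟩ := exists_add_smul_mul_eq hlam1 h₁
    obtain ⟨s₂, hs₂⟩ := exists_add_smul_mul_eq hlam1 h₂
    have htriv : ∀ s : k, s • ((g : H) - 1) ∈ coradical k H := fun s =>
      Submodule.smul_mem _ s (sub_one_mem_coradical g)
    have htriv' : ∀ s : k, s • ((g : H) - 1) ∈ skewPrimitives g := fun s =>
      Submodule.smul_mem _ s (sub_one_mem_skewPrimitives g)
    obtain ⟨s, hs⟩ := exists_sub_smul_mem_of_isPrimitiveRoot hpt hlt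
      (orderOf_pos_iff.2 (isOfFinOrder_iff_pow_eq_one.2 ⟨m + 1, m.succ_pos, hpow⟩))
      (IsPrimitiveRoot.orderOf lam) (add_mem hy₁.1 (htriv' s₁)) (add_mem hy₂.1 (htriv' s₂)) hs₁ hs₂
      (fun h => hy₁C (by simpa using sub_mem h (htriv s₁)))
    refine ⟨s, ?_⟩
    have := add_mem (sub_mem hs (htriv s₂)) (Submodule.smul_mem _ s (htriv s₁))
    convert this using 1
    rw [smul_add]
    abel

end SkewPrimitive

end PointedHopf

end

theorem theorem3p7 {k H : Type*} [Field k] [IsAlgClosed k] [CharZero k]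
    [Ring H] [IsDomain H] [HopfAlgebra k H]
    (hpointed : PointedHopf.IsPointed k H)
    (hcomm : ∀ x ∈ PointedHopf.coradical k H, ∀ y ∈ PointedHopf.coradical k H, x * y = y * x)
    (hlt : PointedHopf.gkDim k H <
      PointedHopf.gkDim k (PointedHopf.coradicalSubalgebra k H) + 2)
    (hfin : PointedHopf.gkDim k (PointedHopf.coradicalSubalgebra k H) + 2 < ⊤)
    (g : GroupLike k H) (lam : k) :
    Module.rank k (PointedHopf.SkewPrimitivesQuotient g lam 1) ≤ 1 := by
  have hmk : ∀ (y₁ y₂ : PointedHopf.skewPrimitivesWithCommutator g lam 1) (s : k),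
      (y₂ : H) - s • (y₁ : H) ∈ PointedHopf.coradical k H →
      s • (Submodule.Quotient.mk y₁ : PointedHopf.SkewPrimitivesQuotient g lam 1) =
        Submodule.Quotient.mk y₂ := by
    intro y₁ y₂ s hs
    obtain ⟨c, hc⟩ := PointedHopf.exists_eq_smul_sub_one hpointed
      (sub_mem y₂.2.1 (Submodule.smul_mem _ s y₁.2.1)) hs
    rw [← Submodule.Quotient.mk_smul, eq_comm, Submodule.Quotient.eq]
    exact Submodule.mem_span_singleton.2 ⟨c, hc.symm⟩
  rw [rank_le_one_iff]
  by_cases h : ∃ y₁ : PointedHopf.skewPrimitivesWithCommutator g lam 1,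
      (y₁ : H) ∉ PointedHopf.coradical k H
  · obtain ⟨y₁, hy₁⟩ := h
    refine ⟨Submodule.Quotient.mk y₁, fun v => ?_⟩
    obtain ⟨y₂, rfl⟩ := Submodule.Quotient.mk_surjective _ v
    obtain ⟨s, hs⟩ := PointedHopf.exists_sub_smul_mem hpointed hlt y₁.2 y₂.2 hy₁
    exact ⟨s, hmk y₁ y₂ s hs⟩
  · push Not at h
    refine ⟨0, fun v => ⟨0, ?_⟩⟩
    obtain ⟨y₂, rfl⟩ := Submodule.Quotient.mk_surjective _ v
    simpa using hmk 0 y₂ 0 (by simpa using h y₂)
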